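/- A *space* is a separable metrizable topological space. A subset $A$ of a space $X$ is *analytic* (respectively *coanalytic*) in $X$ if there are a Polish space $T$ containing $X$ as a subspace and an analytic subset (respectively, a complement of an analytic subset) $B$ of $T$ such that $A = B\cap X$. The space $X$ has $\mathsf{PSP(analytic)}$ (respectively $\mathsf{PSP(coanalytic)}$) if every analytic (respectively coanalytic) subset of $X$ is either countable or contains a subspace homeomorphic to the Cantor space $2^\omega$. **Proposition 4.3 (Miller).** There exists a space $X$ that has $\mathsf{PSP(analytic)}$ but does not have $\mathsf{PSP(coanalytic)}$. Moreover, the following spaces are examples. Let $\langle\cdot,\cdot\rangle:\omega\times\omega\to\omega$ be the canonical pairing bijection, $\langle m,n\rangle = n^2+m$ if $m<n$ and $\langle m,n\rangle = m^2+m+n$ otherwise. For $x\in\omega^\omega$ let $E_x$ be the binary relation on $\omega$ given by $m\mathrel{E_x}n \iff x(\langle m,n\rangle)=0$, and let $\mathsf{WO}$ be the set of all $x\in\omega^\omega$ such that $E_x$ is a strict well-ordering of $\omega$. For each ordinal $\alpha$ with $\omega\le\alpha<\omega_1$ let $z_\alpha\in\mathsf{WO}$ be such that $E_{z_\alpha}$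 has order type $\alpha$, and put $Z=\{z_\alpha:\omega\le\alpha<\omega_1\}$. Then, for every such choice of the $z_\alpha$, the subspace $X=Z\cup(\omega^\omega\setminus\mathsf{WO})$ of $\omega^\omega$ has $\mathsf{PSP(analytic)}$ but not $\mathsf{PSP(coanalytic)}$. -/

import Mathlib

open Topology

universe u

/-- A (boldface) pointclass: for each topological space `T`, a family of subsets of `T`.
Only its values at Polish spaces `T` are used below. -/
def Pointclass : Type (u + 1) :=
  ∀ (T : Type u) [TopologicalSpace T], Set T → Prop

/-- The pointclass of analytic sets: continuous images of Polish spaces. -/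
def Pointclass.analytic : Pointclass.{u} :=
  fun T _ B => MeasureTheory.AnalyticSet (α := T) B

/-- The pointclass of coanalytic sets: complements of analytic sets. -/
def Pointclass.coanalytic : Pointclass.{u} :=
  fun T _ B => MeasureTheory.AnalyticSet (α := T) Bᶜ

/-- `A` is a `Γ` subset of the space `X`: there are a Polish space `T` containing `X` as a
subspace (through a topological embedding `e`) and a `Γ` subset `B` of `T` whose trace
on `X` is `A`. A Polish space has at most continuum many points, so it does not matter
in which universe `T` lives. -/
def IsPointclassSubset (Γ : Pointclass.{u}) {X : Type u} [TopologicalSpace X]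
    (A : Set X) : Prop :=
  ∃ (T : Type u) (_ : TopologicalSpace T) (_ : PolishSpace T) (e : X → T) (B : Set T),
    IsEmbedding e ∧ Γ T B ∧ A = e ⁻¹' B

/-- `A` contains a copy of the Cantor space `2^ω`. -/
def ContainsCantor {X : Type u} [TopologicalSpace X] (A : Set X) : Prop :=
  ∃ f : (ℕ → Bool) → X, IsEmbedding f ∧ Set.range f ⊆ A

/-- The perfect set property of the space `X` for `Γ` subsets. -/
def PSP (Γ : Pointclass.{u}) (X : Type u) [TopologicalSpace X] : Prop :=
  ∀ A : Set X, IsPointclassSubset Γ A → A.Countable ∨ ContainsCantor A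

/-- The binary relation `E_x` on `ω` coded by `x ∈ ω^ω`: `m E_x n` iff `x(⟨m, n⟩) = 0`,
where `⟨·, ·⟩` is the canonical pairing bijection of `ω × ω` with `ω`. -/
def codedRel (x : ℕ → ℕ) (m n : ℕ) : Prop :=
  x (Nat.pair m n) = 0

/-- `WO`: the set of codes of (strict) well-orderings of `ω`. -/
def WO : Set (ℕ → ℕ) :=
  {x | IsWellOrder ℕ (codedRel x)}

/-- `x` codes a well-ordering of `ω` of order type `α`. -/
def CodesOrdinal (x : ℕ → ℕ) (α : Ordinal.{0}) : Prop :=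
  ∃ _ : IsWellOrder ℕ (codedRel x), Ordinal.type (codedRel x) = α

/-- The subset `Z ∪ (ω^ω ∖ WO)` of the Baire space, where `Z = {z α : ω ≤ α < ω₁}`. -/
def millerSet (z : Ordinal.{0} → ℕ → ℕ) : Set (ℕ → ℕ) :=
  z '' Set.Ico Ordinal.omega0 (Ordinal.omega 1) ∪ WOᶜ

/-!
Everything rests on two classical facts about analytic sets. The perfect set theorem
(`MeasureTheory.AnalyticSet.countable_or_containsCantor`) is proved by a Cantor scheme of closed
sets in the domain of a parametrization. Boundedness
(`MeasureTheory.AnalyticSet.exists_countable_Iio_subset`) says that an analytic set of codes of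
well-orderings codes only countably many ordinals. For an analytic set `range f ⊆ WO`, consider the
tree of pairs consisting of an initial segment of some `y` and a finite sequence that descends in
the relation coded by `f y`. An infinite branch would yield, by continuity of `f`, a descending
sequence in a relation coded by a point of the range, so the tree is well-founded; it lives on a
countable set, so its ranks form a countable initial segment of the ordinals, and they dominate the
ranks in every relation coded by a point of `range f`.

Now let `X = Z ∪ (ω^ω ∖ WO)`. An analytic subset of `X` is the trace `B ∩ X` of an analytic
`B ⊆ ω^ω` (`IsPointclassSubset.exists_analyticSet_eq_preimage`). Since `ω^ω ∖ WO` is analytic, so is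
`B ∖ WO`, and if it is uncountable it contains a Cantor set. Otherwise `B ∩ WO` differs from `B` by
a countable set, so it is analytic, meets `Z` in a countable set by boundedness, and `B ∩ X` is
countable. On the other hand `Z = X ∩ WO` is an uncountable coanalytic subset of `X`, while a
Cantor set contained in `Z` would be an analytic set of codes of uncountably many ordinals.
-/

/-! ### The perfect set theorem for analytic sets -/

/-- One step of the Cantor scheme: if a closed set `E` has uncountable image, then two closed
subsets of small diameter still have uncountable images, and these images are disjoint. -/
theorem exists_closed_splitting_of_not_countable_image {α X : Type*} [MetricSpace α]
    [SecondCountableTopology α] [TopologicalSpace X] [T2Space X] {f : α → X} (hf : Continuous f)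
    {E : Set α} (hE : IsClosed E) (hunc : ¬ (f '' E).Countable) {ε : ENNReal} (hε : 0 < ε) :
    ∃ E₀ E₁ : Set α,
      (IsClosed E₀ ∧ ¬ (f '' E₀).Countable ∧ E₀ ⊆ E ∧ Metric.ediam E₀ ≤ ε) ∧
      (IsClosed E₁ ∧ ¬ (f '' E₁).Countable ∧ E₁ ⊆ E ∧ Metric.ediam E₁ ≤ ε) ∧
      Disjoint (f '' E₀) (f '' E₁) := by
  -- The points of `E` all of whose neighbourhoods have uncountable image.
  set K : Set α := {x ∈ E | ∀ U ∈ 𝓝 x, ¬ (f '' (U ∩ E)).Countable} with hK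
  have hEK : (f '' (E \ K)).Countable := by
    refine (HereditarilyLindelofSpace.isLindelof (E \ K)).induction_on
      (p := fun t => (f '' t).Countable)
      (fun s t hst ht => ht.mono (Set.image_mono hst)) (fun S hS h => ?_) (fun x hx => ?_)
    · rw [Set.image_sUnion]
      exact (hS.image _).sUnion (by rintro _ ⟨t, ht, rfl⟩; exact h t ht)
    · have hx' : ∃ U ∈ 𝓝 x, (f '' (U ∩ E)).Countable := by
        by_contra! h
        exact hx.2 ⟨hx.1, h⟩
      obtain ⟨U, hU, hc⟩ := hx'
      refine ⟨U ∩ (E \ K), Filter.inter_mem (mem_nhdsWithin_of_mem_nhds hU)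
        self_mem_nhdsWithin, hc.mono (Set.image_mono ?_)⟩
      exact Set.inter_subset_inter_right _ Set.sdiff_subset
  have hKunc : ¬ (f '' K).Subsingleton := fun h => hunc <| by
    refine (hEK.union h.countable).mono ?_
    rw [← Set.image_union]
    exact Set.image_mono (by intro x hx; by_cases hxK : x ∈ K <;> simp [hx, hxK])
  rw [Set.not_subsingleton_iff] at hKunc
  obtain ⟨_, ⟨x, hx, rfl⟩, _, ⟨y, hy, rfl⟩, hxy⟩ := hKunc
  obtain ⟨V, W, hV, hW, hxV, hyW, hVW⟩ := t2_separation hxy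
  have key : ∀ z ∈ K, ∀ V : Set X, IsOpen V → f z ∈ V → ∃ F : Set α,
      (IsClosed F ∧ ¬ (f '' F).Countable ∧ F ⊆ E ∧ Metric.ediam F ≤ ε) ∧ f '' F ⊆ V := by
    intro z hz V hV hzV
    obtain ⟨r, hr, hrV⟩ := Metric.nhds_basis_closedEBall.mem_iff.1
      ((hV.preimage hf).mem_nhds hzV)
    have hr' : 0 < min r (ε / 2) := lt_min hr (ENNReal.half_pos hε.ne')
    refine ⟨Metric.closedEBall z (min r (ε / 2)) ∩ E,
      ⟨Metric.isClosed_closedEBall.inter hE,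
        hz.2 _ (Metric.closedEBall_mem_nhds _ hr'), Set.inter_subset_right, ?_⟩, ?_⟩
    · calc _ ≤ Metric.ediam (Metric.closedEBall z (min r (ε / 2))) :=
            Metric.ediam_mono Set.inter_subset_left
        _ ≤ 2 * min r (ε / 2) := Metric.ediam_closedEBall_le
        _ ≤ 2 * (ε / 2) := by gcongr; exact min_le_right _ _
        _ = ε := by rw [mul_comm, ENNReal.div_mul_cancel] <;> norm_num
    · rintro _ ⟨w, hw, rfl⟩
      exact hrV (Metric.closedEBall_subset_closedEBall (min_le_left _ _) hw.1)
  obtain ⟨F, hF, hFV⟩ := key x hx V hV hxV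
  obtain ⟨G, hG, hGW⟩ := key y hy W hW hyW
  exact ⟨F, G, hF, hG, hVW.mono hFV hGW⟩

open CantorScheme in
/-- A continuous map with uncountable range on a Polish space is injective on a copy of the
Cantor space. -/
theorem Continuous.exists_nat_bool_injective_comp {α X : Type*} [TopologicalSpace α]
    [PolishSpace α] [TopologicalSpace X] [T2Space X] {f : α → X} (hf : Continuous f)
    (hunc : ¬ (Set.range f).Countable) :
    ∃ g : (ℕ → Bool) → α, Continuous g ∧ Function.Injective (f ∘ g) := by
  let := TopologicalSpace.upgradeIsCompletelyMetrizable α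
  obtain ⟨u, -, upos', hu⟩ := exists_seq_strictAnti_tendsto' (zero_lt_one' ENNReal)
  have upos := fun n => (upos' n).1
  let P := Subtype fun E : Set α => IsClosed E ∧ ¬ (f '' E).Countable
  choose C0 C1 h0 h1 hdisj using
    fun {C : Set α} (hC : IsClosed C) (hunc : ¬ (f '' C).Countable) {ε : ENNReal} (hε : 0 < ε) =>
    exists_closed_splitting_of_not_countable_image hf hC hunc hε
  let DP : List Bool → P := fun l => by
    induction l with
    | nil => exact ⟨Set.univ, isClosed_univ, by rwa [Set.image_univ]⟩
    | cons a l ih =>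
      cases a
      · use C0 ih.property.1 ih.property.2 (upos (l.length + 1))
        exact ⟨(h0 _ _ _).1, (h0 _ _ _).2.1⟩
      use C1 ih.property.1 ih.property.2 (upos (l.length + 1))
      exact ⟨(h1 _ _ _).1, (h1 _ _ _).2.1⟩
  let D : List Bool → Set α := fun l => (DP l).val
  have hanti : ClosureAntitone D := by
    refine Antitone.closureAntitone ?_ fun l => (DP l).property.1
    intro l a
    cases a
    · exact (h0 _ _ _).2.2.1
    exact (h1 _ _ _).2.2.1
  have hdiam : VanishingDiam D := by
    intro x
    refine tendsto_of_tendsto_of_tendsto_of_le_of_le' tendsto_const_nhds hu ?_ ?_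
    · simp
    filter_upwards [Filter.eventually_ge_atTop 1] with m hm
    obtain ⟨n, rfl⟩ := Nat.exists_eq_succ_of_ne_zero (Nat.one_le_iff_ne_zero.1 hm)
    dsimp
    cases x n
    · convert! (h0 _ _ _).2.2.2
      rw [PiNat.res_length]
    convert! (h1 _ _ _).2.2.2
    rw [PiNat.res_length]
  have hdisj' : CantorScheme.Disjoint fun l => f ⁻¹' (f '' D l) := by
    have : ∀ l, Disjoint (f '' D (false :: l)) (f '' D (true :: l)) := fun l => hdisj _ _ _
    rintro l (a | a) (b | b) hab <;> try contradiction
    · exact (this l).preimage f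
    · exact ((this l).preimage f).symm
  have hne : ∀ l, (D l).Nonempty := fun l => by
    by_contra h
    rw [Set.not_nonempty_iff_eq_empty] at h
    exact (DP l).property.2 (by change (f '' D l).Countable; simp [h])
  have hdom : ∀ {x : ℕ → Bool}, x ∈ (inducedMap D).1 := fun {x} => by
    rw [hanti.map_of_vanishingDiam hdiam hne]
    apply Set.mem_univ
  refine ⟨fun x => (inducedMap D).2 ⟨x, hdom⟩, hdiam.map_continuous.comp (by fun_prop), ?_⟩
  intro x y hxy
  have hmem : ∀ x n, (inducedMap D).2 ⟨x, hdom⟩ ∈ D (PiNat.res x n) := fun x n => map_mem _ n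
  apply PiNat.res_injective
  ext n : 1
  induction n with
  | zero => simp
  | succ n ih =>
    simp only [PiNat.res_succ, List.cons.injEq]
    refine ⟨?_, ih⟩
    by_contra hne
    refine Set.disjoint_left.1 (hdisj' (PiNat.res x n) hne)
      (?_ : (inducedMap D).2 ⟨x, hdom⟩ ∈ _) ?_
    · rw [← PiNat.res_succ]
      exact ⟨_, hmem x (n + 1), rfl⟩
    · dsimp only
      rw [ih, ← PiNat.res_succ]
      exact ⟨_, hmem y (n + 1), hxy.symm⟩

/-- The **perfect set theorem** (Souslin): an uncountable analytic set contains a copy of the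
Cantor space. -/
theorem MeasureTheory.AnalyticSet.countable_or_containsCantor {X : Type*} [TopologicalSpace X]
    [T2Space X] {s : Set X} (hs : MeasureTheory.AnalyticSet s) :
    s.Countable ∨ ContainsCantor s := by
  rw [MeasureTheory.analyticSet_iff_exists_polishSpace_range] at hs
  obtain ⟨β, _, _, f, hf, rfl⟩ := hs
  refine or_iff_not_imp_left.2 fun hunc => ?_
  obtain ⟨g, hg, hinj⟩ := hf.exists_nat_bool_injective_comp hunc
  exact ⟨f ∘ g, ((hf.comp hg).isClosedEmbedding hinj).isEmbedding, Set.range_comp_subset_range g f⟩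

/-! ### Boundedness of analytic sets of codes of well-orderings -/

/-- The one-step extension relation on the tree attached to `f : ω^ω → ω^ω`. A node is a pair of
finite sequences of the same length `n`, both in the reversed form of `PiNat.res`: an initial
segment of a point `y`, and a finite sequence `k 0, …, k (n - 1)` that descends in
`codedRel (f y)` for some such `y`. Larger nodes are below smaller ones, so that an infinite branch
of the tree is a descending sequence of the relation. -/
def descentTree (f : (ℕ → ℕ) → ℕ → ℕ) (q p : List ℕ × List ℕ) : Prop :=
  ∃ (n : ℕ) (y k : ℕ → ℕ),
    p = (PiNat.res y n, PiNat.res k n) ∧ q = (PiNat.res y (n + 1), PiNat.res k (n + 1)) ∧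
      ∀ i < n, codedRel (f y) (k (i + 1)) (k i)

/-- Membership in the tree is witnessed by a different point `y` at each node, but along an
infinite branch these points converge, and by continuity of `f` the whole branch descends in the
relation coded at the limit. -/
theorem wellFounded_descentTree {f : (ℕ → ℕ) → ℕ → ℕ} (hf : Continuous f)
    (hwf : ∀ y, WellFounded (codedRel (f y))) : WellFounded (descentTree f) := by
  rw [wellFounded_iff_isEmpty_descending_chain]
  refine ⟨fun ⟨p, hp⟩ => ?_⟩
  choose n y k hpn hqn hk using hp
  have hstep : ∀ i, n (i + 1) = n i + 1 ∧ (∀ m < n i + 1, y i m = y (i + 1) m) ∧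
      ∀ m < n i + 1, k i m = k (i + 1) m := by
    intro i
    have h := (hqn i).symm.trans (hpn (i + 1))
    rw [Prod.mk.injEq] at h
    have hn : n (i + 1) = n i + 1 := by simpa using (congrArg List.length h.1).symm
    rw [hn] at h
    exact ⟨hn, fun m hm => PiNat.res_eq_res.1 h.1 hm, fun m hm => PiNat.res_eq_res.1 h.2 hm⟩
  have hn : ∀ i, i ≤ n i := by
    intro i
    induction i with
    | zero => simp
    | succ i ih => rw [(hstep i).1]; lia
  -- The limit point of the `y i` and the limit sequence of the `k i`.
  set y' : ℕ → ℕ := fun m => y m m with hy'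
  set k' : ℕ → ℕ := fun m => k m m with hk'
  have hyy : ∀ m j, m ≤ j → y j m = y' m := by
    intro m j hj
    induction j, hj using Nat.le_induction with
    | base => rfl
    | succ j hj ih => rw [← ih, (hstep j).2.1 m (by have := hn j; lia)]
  have hkk : ∀ m j, m ≤ j → k j m = k' m := by
    intro m j hj
    induction j, hj using Nat.le_induction with
    | base => rfl
    | succ j hj ih => rw [← ih, (hstep j).2.2 m (by have := hn j; lia)]
  have hlim : Filter.Tendsto y Filter.atTop (𝓝 y') := by
    rw [tendsto_pi_nhds]
    intro m
    refine tendsto_const_nhds.congr' ?_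
    filter_upwards [Filter.eventually_ge_atTop m] with j hj
    exact (hyy m j hj).symm
  refine (wellFounded_iff_isEmpty_descending_chain.1 (hwf y')).false ⟨k', fun i => ?_⟩
  have hev := (tendsto_pi_nhds.1 ((hf.tendsto y').comp hlim)
    (Nat.pair (k' (i + 1)) (k' i))).eventually
      ((isOpen_discrete {f y' (Nat.pair (k' (i + 1)) (k' i))}).mem_nhds rfl)
  obtain ⟨j, hj, hij⟩ := (hev.and (Filter.eventually_ge_atTop (i + 1))).exists
  have h := hk j i (by have := hn j; lia)
  rw [hkk i j (by lia), hkk (i + 1) j hij] at h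
  exact (show f (y j) _ = f y' _ from hj).symm.trans h

/-- **Boundedness**: the ordinals coded by the elements of an analytic set of codes of
well-orderings have all their predecessors in one countable set. -/
theorem MeasureTheory.AnalyticSet.exists_countable_Iio_subset {A : Set (ℕ → ℕ)}
    (hA : MeasureTheory.AnalyticSet A) (hWO : A ⊆ WO) :
    ∃ C : Set Ordinal.{0}, C.Countable ∧
      ∀ x ∈ A, ∀ α, CodesOrdinal x α → Set.Iio α ⊆ C := by
  rw [MeasureTheory.AnalyticSet] at hA
  obtain rfl | ⟨f, hf, rfl⟩ := hA
  · exact ⟨∅, Set.countable_empty, by simp⟩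
  have hwf : ∀ y, WellFounded (codedRel (f y)) := fun y =>
    have : IsWellOrder ℕ (codedRel (f y)) := hWO ⟨y, rfl⟩
    IsWellFounded.wf
  have : IsWellFounded _ (descentTree f) := ⟨wellFounded_descentTree hf hwf⟩
  refine ⟨Set.range (IsWellFounded.rank (descentTree f)), Set.countable_range _, ?_⟩
  rintro _ ⟨y, rfl⟩ α ⟨hwo, rfl⟩ o ho
  -- A descending sequence `k 0, …, k n = a` is a node of the tree whose rank is at least that of
  -- `a`, because every `b` below `a` extends the sequence.
  have key : ∀ (a n : ℕ) (k : ℕ → ℕ), k n = a → (∀ i < n, codedRel (f y) (k (i + 1)) (k i)) →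
      IsWellFounded.rank (codedRel (f y)) a ≤
        IsWellFounded.rank (descentTree f) (PiNat.res y (n + 1), PiNat.res k (n + 1)) := by
    intro a
    induction a using (hwf y).induction with
    | h a ih =>
    intro n k hka hk
    rw [IsWellFounded.rank_eq]
    refine Ordinal.iSup_le fun ⟨b, hb⟩ => Order.succ_le_of_lt ?_
    have hupd : ∀ i ≤ n, Function.update k (n + 1) b i = k i := fun i hi =>
      Function.update_of_ne (by lia) _ _
    have hk' : ∀ i < n + 1, codedRel (f y) (Function.update k (n + 1) b (i + 1))
        (Function.update k (n + 1) b i) := by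
      intro i hi
      rw [hupd i (by lia)]
      obtain hi | rfl := Nat.lt_succ_iff_lt_or_eq.1 hi
      · rw [hupd (i + 1) (by lia)]
        exact hk i hi
      · rwa [Function.update_self, hka]
    refine (ih b hb (n + 1) (Function.update k (n + 1) b) (by simp) hk').trans_lt
      (IsWellFounded.rank_lt_of_rel ⟨n + 1, y, Function.update k (n + 1) b, ?_, rfl, hk'⟩)
    rw [Prod.mk.injEq]
    exact ⟨rfl, PiNat.res_eq_res.2 fun m hm => (hupd m (by lia)).symm⟩
  obtain ⟨a, rfl⟩ := Ordinal.typein_surj (codedRel (f y)) ho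
  rw [← IsWellFounded.rank_eq_typein]
  exact IsWellFounded.mem_range_rank_of_le (key a 0 (fun _ => a) rfl (by simp))

theorem Set.Countable.ofPred_Iio_subset {α : Type*} [LinearOrder α] {C : Set α}
    (hC : C.Countable) : {a | Set.Iio a ⊆ C}.Countable := by
  -- Of two elements of the set, the smaller one lies in `C`.
  have h : ({a | Set.Iio a ⊆ C} \ C).Subsingleton := by
    rintro a ⟨ha, haC⟩ b ⟨hb, hbC⟩
    by_contra hab
    obtain h | h := lt_or_gt_of_ne hab
    · exact haC (hb h)
    · exact hbC (ha h)
  refine (hC.union h.countable).mono fun a ha => ?_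
  by_cases haC : a ∈ C
  · exact Or.inl haC
  · exact Or.inr ⟨ha, haC⟩

/-- An analytic set of codes of well-orderings codes only countably many ordinals. -/
theorem MeasureTheory.AnalyticSet.countable_codesOrdinal {A : Set (ℕ → ℕ)}
    (hA : MeasureTheory.AnalyticSet A) (hWO : A ⊆ WO) :
    {α | ∃ x ∈ A, CodesOrdinal x α}.Countable := by
  obtain ⟨C, hC, h⟩ := hA.exists_countable_Iio_subset hWO
  exact hC.ofPred_Iio_subset.mono fun α ⟨x, hx, hxα⟩ => h x hx α hxα

/-! ### Analytic sets -/

theorem MeasureTheory.AnalyticSet.union {X : Type*} [TopologicalSpace X] {s t : Set X}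
    (hs : MeasureTheory.AnalyticSet s) (ht : MeasureTheory.AnalyticSet t) :
    MeasureTheory.AnalyticSet (s ∪ t) := by
  rw [Set.union_eq_iUnion]
  exact .iUnion (Bool.rec ht hs)

theorem MeasureTheory.AnalyticSet.inter {X : Type*} [TopologicalSpace X] [T2Space X] {s t : Set X}
    (hs : MeasureTheory.AnalyticSet s) (ht : MeasureTheory.AnalyticSet t) :
    MeasureTheory.AnalyticSet (s ∩ t) := by
  rw [Set.inter_eq_iInter]
  exact .iInter (Bool.rec ht hs)

theorem MeasureTheory.AnalyticSet.diff_countable {X : Type*} [TopologicalSpace X] [PolishSpace X]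
    {s t : Set X} (hs : MeasureTheory.AnalyticSet s) (ht : t.Countable) :
    MeasureTheory.AnalyticSet (s \ t) := by
  borelize X
  exact hs.inter ht.measurableSet.compl.analyticSet

/-- The codes of ill-founded relations form the projection of a closed set, and those of relations
that are not trichotomous a countable union of closed sets. -/
theorem analyticSet_compl_WO : MeasureTheory.AnalyticSet WOᶜ := by
  have heq : WOᶜ = (Prod.fst '' {p : (ℕ → ℕ) × (ℕ → ℕ) | ∀ i, codedRel p.1 (p.2 (i + 1)) (p.2 i)})
      ∪ ⋃ q : {q : ℕ × ℕ // q.1 ≠ q.2},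
        {x | ¬ codedRel x q.1.1 q.1.2 ∧ ¬ codedRel x q.1.2 q.1.1} := by
    ext x
    have hiff : x ∈ WO ↔ WellFounded (codedRel x) ∧
        ∀ a b, ¬ codedRel x a b → ¬ codedRel x b a → a = b :=
      ⟨fun h => ⟨h.wf, h.trichotomous⟩, fun h => { wf := h.1, trichotomous := h.2 }⟩
    rw [Set.mem_compl_iff, hiff, not_and_or, wellFounded_iff_isEmpty_descending_chain,
      not_isEmpty_iff]
    refine or_congr ?_ ?_
    · constructor
      · rintro ⟨s, hs⟩
        exact ⟨(x, s), hs, rfl⟩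
      · rintro ⟨⟨x, s⟩, hs, rfl⟩
        exact ⟨s, hs⟩
    · push Not
      simp only [Set.mem_iUnion, Subtype.exists, Prod.exists]
      exact ⟨fun ⟨a, b, h1, h2, h3⟩ => ⟨a, b, h3, h1, h2⟩, fun ⟨a, b, h3, h1, h2⟩ =>
        ⟨a, b, h1, h2, h3⟩⟩
  rw [heq]
  refine MeasureTheory.AnalyticSet.union ?_ (.iUnion fun q => ?_)
  · refine MeasureTheory.AnalyticSet.image_of_continuous (IsClosed.analyticSet ?_) continuous_fst
    have heval : Continuous fun p : (ℕ → ℕ) × ℕ => p.1 p.2 :=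
      continuous_prod_of_discrete_right.2 fun n => continuous_apply n
    have hpair : Continuous fun q : ℕ × ℕ => Nat.pair q.1 q.2 := continuous_of_discreteTopology
    simp only [Set.ofPred_forall]
    refine isClosed_iInter fun i => isClosed_singleton.preimage (f := fun p : (ℕ → ℕ) × (ℕ → ℕ) =>
      p.1 (Nat.pair (p.2 (i + 1)) (p.2 i))) (heval.comp (continuous_fst.prodMk
        (hpair.comp (f := fun p : (ℕ → ℕ) × (ℕ → ℕ) => (p.2 (i + 1), p.2 i)) (by fun_prop))))
  · refine IsClosed.analyticSet (IsClosed.inter ?_ ?_)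
    · exact (isClosed_discrete {0}ᶜ).preimage (continuous_apply (Nat.pair q.1.1 q.1.2))
    · exact (isClosed_discrete {0}ᶜ).preimage (continuous_apply (Nat.pair q.1.2 q.1.1))

/-- An analytic subset of a subspace `X` of a Polish space `Y` is the trace of an analytic subset
of `Y`, whichever Polish space `T ⊇ X` witnesses its analyticity: the closure of the graph of
`X → T` in `Y × T` has the same fibres over points of `X`. -/
theorem IsPointclassSubset.exists_analyticSet_eq_preimage {Y : Type} [TopologicalSpace Y]
    [PolishSpace Y] {X : Set Y} {A : Set X} (hA : IsPointclassSubset Pointclass.analytic A) :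
    ∃ B : Set Y, MeasureTheory.AnalyticSet B ∧ A = Subtype.val ⁻¹' B := by
  obtain ⟨T, _, _, e, B, he, hB, rfl⟩ := hA
  have hB : MeasureTheory.AnalyticSet B := hB
  set C : Set (Y × T) := closure (Set.range fun x : X => ((x : Y), e x)) with hC
  refine ⟨Prod.fst '' (C ∩ Prod.snd ⁻¹' B),
    (isClosed_closure.analyticSet.inter (hB.preimage continuous_snd)).image_of_continuous
      continuous_fst, ?_⟩
  ext x
  constructor
  · exact fun hx => ⟨(x, e x), ⟨subset_closure ⟨x, rfl⟩, hx⟩, rfl⟩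
  · rintro ⟨⟨y, t⟩, ⟨hyt, ht⟩, rfl : y = x⟩
    suffices h : t = e x by rwa [h] at ht
    by_contra hne
    obtain ⟨V, W, hV, hW, htV, hxW, hVW⟩ := t2_separation hne
    obtain ⟨O, hO, hOW⟩ := isOpen_induced_iff.1 (hW.preimage he.continuous)
    have hxO : x ∈ Subtype.val ⁻¹' O := by rw [hOW]; exact hxW
    obtain ⟨_, ⟨hx'O, hx'V⟩, x', rfl⟩ := mem_closure_iff.1 hyt (O ×ˢ V) (hO.prod hV) ⟨hxO, htV⟩
    have hx'W : x' ∈ e ⁻¹' W := by rw [← hOW]; exact hx'O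
    exact Set.disjoint_left.1 hVW hx'V hx'W

/-! ### The spaces of Miller -/

theorem ContainsCantor.preimage_val {Y : Type*} [TopologicalSpace Y] {X B : Set Y}
    (hB : ContainsCantor B) (hBX : B ⊆ X) : ContainsCantor (Subtype.val ⁻¹' B : Set X) := by
  obtain ⟨g, hg, hgB⟩ := hB
  have hgB' : ∀ c, g c ∈ B := fun c => hgB ⟨c, rfl⟩
  refine ⟨Set.codRestrict g X fun c => hBX (hgB' c), hg.codRestrict _ _, ?_⟩
  rintro _ ⟨c, rfl⟩
  exact hgB' c

/-- If `A` is the trace of the analytic set `B`, then either the analytic set `B ∖ WO ⊆ X` contains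
a Cantor set, or it is countable, so that `B ∩ WO` is analytic and boundedness applies. -/
theorem psp_analytic_millerSet {z : Ordinal.{0} → ℕ → ℕ}
    (hz : ∀ α : Ordinal.{0}, Ordinal.omega0 ≤ α → α < Ordinal.omega 1 → CodesOrdinal (z α) α) :
    PSP Pointclass.analytic (millerSet z) := by
  intro A hA
  obtain ⟨B, hB, rfl⟩ := hA.exists_analyticSet_eq_preimage
  obtain hcount | hcantor := (hB.inter analyticSet_compl_WO).countable_or_containsCantor
  · left
    have hB' : MeasureTheory.AnalyticSet (B ∩ WO) := by
      rw [show B ∩ WO = B \ (B ∩ WOᶜ) by ext; simp]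
      exact hB.diff_countable hcount
    have hord := (hB'.countable_codesOrdinal Set.inter_subset_right).image z
    refine ((hcount.union hord).preimage Subtype.val_injective).mono ?_
    rintro ⟨x, hx⟩ (hxB : x ∈ B)
    by_cases hxWO : x ∈ WO
    · obtain ⟨α, hα, rfl⟩ := hx.resolve_right (not_not.2 hxWO)
      exact Or.inr ⟨α, ⟨z α, ⟨hxB, hxWO⟩, hz α hα.1 hα.2⟩, rfl⟩
    · exact Or.inl ⟨hxB, hxWO⟩
  · right
    obtain ⟨g, hg, hgA⟩ := hcantor.preimage_val
      (Set.inter_subset_right.trans Set.subset_union_right : _ ⊆ millerSet z)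
    exact ⟨g, hg, hgA.trans fun x hx => hx.1⟩

theorem not_countable_Ico_omega0_omega_one :
    ¬ (Set.Ico Ordinal.omega0.{0} (Ordinal.omega 1)).Countable := by
  intro h
  have hω : (Set.Iio Ordinal.omega0.{0}).Countable := by
    rw [← Cardinal.le_aleph0_iff_set_countable, Cardinal.mk_Iio_ordinal]
    simp
  have hω₁ := hω.union h
  rw [Set.Iio_union_Ico_eq_Iio Ordinal.omega0_lt_omega_one.le,
    ← Cardinal.le_aleph0_iff_set_countable, Cardinal.mk_Iio_ordinal] at hω₁
  simp [← not_lt] at hω₁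

/-- The witness is the coanalytic subset `Z = X ∩ WO` of `X`: a Cantor set inside `Z` would be an
analytic set of codes, hence would contain only countably many of the `z α`. -/
theorem not_psp_coanalytic_millerSet {z : Ordinal.{0} → ℕ → ℕ}
    (hz : ∀ α : Ordinal.{0}, Ordinal.omega0 ≤ α → α < Ordinal.omega 1 → CodesOrdinal (z α) α) :
    ¬ PSP Pointclass.coanalytic (millerSet z) := by
  intro h
  obtain hcount | ⟨g, hg, hgWO⟩ := h (Subtype.val ⁻¹' WO)
    ⟨ℕ → ℕ, inferInstance, inferInstance, Subtype.val, WO, .subtypeVal, analyticSet_compl_WO, rfl⟩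
  · have hmem : ∀ α : Set.Ico Ordinal.omega0.{0} (Ordinal.omega 1), z α ∈ millerSet z := fun α =>
      Or.inl ⟨α, α.2, rfl⟩
    have hinj : Function.Injective fun α : Set.Ico Ordinal.omega0.{0} (Ordinal.omega 1) =>
        (⟨z α, hmem α⟩ : millerSet z) := by
      intro α β hαβ
      obtain ⟨_, hα⟩ := hz α α.2.1 α.2.2
      obtain ⟨_, hβ⟩ := hz β β.2.1 β.2.2
      have hzz : z α = z β := congrArg Subtype.val hαβ
      apply Subtype.ext
      rw [← hα, ← hβ]
      congr! 1
      rw [hzz]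
    have hIco : (Set.Ico Ordinal.omega0.{0} (Ordinal.omega 1)).Countable := by
      refine Set.countable_univ_iff.1 ((hcount.preimage hinj).mono fun α _ => ?_)
      exact (hz α α.2.1 α.2.2).1
    exact not_countable_Ico_omega0_omega_one hIco
  · set K : Set (ℕ → ℕ) := Set.range (Subtype.val ∘ g) with hK
    have hKWO : K ⊆ WO := by
      rintro _ ⟨c, rfl⟩
      exact hgWO ⟨c, rfl⟩
    have hKan : MeasureTheory.AnalyticSet K :=
      (isCompact_range (continuous_subtype_val.comp hg.continuous)).isClosed.analyticSet
    have hKc : K.Countable := by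
      refine ((hKan.countable_codesOrdinal hKWO).image z).mono ?_
      intro x hx
      obtain ⟨c, rfl⟩ := hx
      obtain ⟨α, hα, hαx⟩ := (g c).2.resolve_right (not_not.2 (hKWO ⟨c, rfl⟩))
      exact ⟨α, ⟨_, ⟨c, rfl⟩, by rw [Function.comp_apply, ← hαx]; exact hz α hα.1 hα.2⟩, hαx⟩
    have hinj : Function.Injective (Subtype.val ∘ g) := Subtype.val_injective.comp hg.injective
    have hle := Cardinal.le_aleph0_iff_set_countable.2
      ((hKc.preimage hinj).mono (s₁ := Set.univ) fun c _ =>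
        show (Subtype.val ∘ g) c ∈ K from ⟨c, rfl⟩)
    exact absurd hle (by simpa using Cardinal.cantor Cardinal.aleph0)

theorem exists_codesOrdinal {α : Ordinal.{0}} (h₀ : Ordinal.omega0 ≤ α)
    (h₁ : α < Ordinal.omega 1) : ∃ x, CodesOrdinal x α := by
  have hcard : Cardinal.mk α.ToType = Cardinal.mk ℕ := by
    rw [Cardinal.mk_toType, Cardinal.mk_nat]
    refine le_antisymm ?_ ?_
    · rwa [← Cardinal.ord_aleph, Cardinal.lt_ord, ← Cardinal.succ_aleph0, Order.lt_succ_iff] at h₁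
    · simpa using Ordinal.card_le_card h₀
  obtain ⟨φ⟩ := Cardinal.eq.1 hcard
  classical
  let r : ℕ → ℕ → Prop := fun m n => φ.symm m < φ.symm n
  let i : r ≃r (fun a b : α.ToType => a < b) := ⟨φ.symm, Iff.rfl⟩
  have hr : codedRel (fun p => if r p.unpair.1 p.unpair.2 then 0 else 1) = r := by
    ext m n
    simp [codedRel]
  refine ⟨fun p => if r p.unpair.1 p.unpair.2 then 0 else 1, ?_⟩
  rw [CodesOrdinal, hr]
  refine ⟨i.toRelEmbedding.isWellOrder, ?_⟩
  have := i.toRelEmbedding.isWellOrder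
  exact i.ordinalType_congr.trans (Ordinal.type_toType α)

theorem proposition4p3 :
    (∃ (X : Type) (_ : TopologicalSpace X),
      TopologicalSpace.SeparableSpace X ∧ TopologicalSpace.MetrizableSpace X ∧
        PSP Pointclass.analytic X ∧ ¬ PSP Pointclass.coanalytic X) ∧
    (∀ z : Ordinal.{0} → ℕ → ℕ,
      (∀ α : Ordinal.{0}, Ordinal.omega0 ≤ α → α < Ordinal.omega 1 → CodesOrdinal (z α) α) →
        PSP Pointclass.analytic (millerSet z) ∧
          ¬ PSP Pointclass.coanalytic (millerSet z)) := by
  have hmain : ∀ z : Ordinal.{0} → ℕ → ℕ,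
      (∀ α : Ordinal.{0}, Ordinal.omega0 ≤ α → α < Ordinal.omega 1 → CodesOrdinal (z α) α) →
        PSP Pointclass.analytic (millerSet z) ∧ ¬ PSP Pointclass.coanalytic (millerSet z) :=
    fun z hz => ⟨psp_analytic_millerSet hz, not_psp_coanalytic_millerSet hz⟩
  refine ⟨?_, hmain⟩
  have hex : ∀ α : Ordinal.{0}, ∃ x, Ordinal.omega0 ≤ α → α < Ordinal.omega 1 →
      CodesOrdinal x α := by
    intro α
    by_cases h : Ordinal.omega0 ≤ α ∧ α < Ordinal.omega 1
    · obtain ⟨x, hx⟩ := exists_codesOrdinal h.1 h.2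
      exact ⟨x, fun _ _ => hx⟩
    · exact ⟨0, fun h₀ h₁ => absurd ⟨h₀, h₁⟩ h⟩
  choose z hz using hex
  exact ⟨millerSet z, inferInstance, inferInstance, inferInstance, hmain z hz⟩
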